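/- For every $n$ let $0\le p=p(n)<q=q(n)\le 1$ and $1\le k=k(n)\le m=m(n)\le n$ (it is enough that these hold for all large $n$). Let $G$ be the random simple graph on $\{1,\dots,n\}$ in which distinct vertices $i,j$ are adjacent independently over pairs, with probability $q$ if $i,j\le m$ and with probability $p$ otherwise (an Erdős–Rényi graph $G(n,p)$ with a planted denser $G(m,q)$). Let $A$ be its adjacency matrix, $D$ the diagonal matrix of the row sums (degrees) of $A$, and $P=D^{-1}A$ (the row of an isolated vertex being zero). Let $\bar A$ be the $n\times n$ matrix with $\bar A_{ij}=q$ if $i,j\le m$ and $\bar A_{ij}=p$ otherwise, $\bar D$ the diagonal matrix of its row sums, and $\bar P=\bar D^{-1}\bar A$. For $0\le\alpha<1$ and $\nu=\left[\frac1k\mathbf 1_k^T\ \mathbf 0_{n-k}^T\right]$ let $$\pi=(1-\alpha)\,\nu\,[I-\alpha P]^{-1},\qquad \bar\pi=(1-\alpha)\,\nu\,[I-\alpha\bar P]^{-1}$$ be the Personalized PageRank and its mean-field version. Assume that $nq(n)=\omega(\log n)$ and $p(n)/q(n)=\Theta(1)$ as $n\to\infty$. Then for every fixed $\alpha\in[0,1)$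 and every sequence $k(n)$ as above the relative error $\|\pi-\bar\pi\|_2/\|\bar\pi\|_2$ converges to $0$ in probability as $n\to\infty$. More precisely, there is a constant $C>0$, which depends on the sequences $m,p,q$ but not on $\alpha$ or $k$, such that for every fixed $\alpha\in[0,1)$ and every such sequence $k(n)$, asymptotically almost surely (with probability tending to $1$ as $n\to\infty$) $G$ has no isolated vertex and $$\frac{\|\pi-\bar\pi\|_2}{\|\bar\pi\|_2}\le\frac{\alpha C}{(1-\alpha)\sqrt{\frac{np(n)}{\log n}}-\alpha C}.$$ -/

import Mathlib

open MeasureTheory ProbabilityTheory Filter Topology unitInterval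
open scoped Matrix

namespace PlantedER

/-- Edge probability of a pair of vertices: `q` if both ends lie in the planted community
`{0, …, m - 1}`, and `p` otherwise. -/
noncomputable def edgeProb {n : ℕ} (m : ℕ) (p q : I) (e : Sym2 (Fin n)) : I :=
  open Classical in if ∀ i ∈ e, i.val < m then q else p

/-- The graph whose edges are the pairs of distinct vertices whose coin shows `true`
(`fromEdgeSet` discards the diagonal). -/
def toGraph {n : ℕ} (ω : Sym2 (Fin n) → Bool) : SimpleGraph (Fin n) :=
  SimpleGraph.fromEdgeSet {e | ω e = true}

/-- The law of the Erdős–Rényi graph `G(n, p)` with a planted `G(m, q)` on the first `m` vertices: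
all pairs of distinct vertices are edges independently, with probability `edgeProb m p q`. -/
noncomputable def law (n m : ℕ) (p q : I) : Measure (SimpleGraph (Fin n)) :=
  (Measure.pi fun e : Sym2 (Fin n) => bernoulliMeasure true false (edgeProb m p q e)).map toGraph

theorem measurable_toGraph {n : ℕ} : Measurable (toGraph (n := n)) := by
  refine SimpleGraph.measurable_fromEdgeSet.comp (measurable_set_iff.2 fun e => ?_)
  exact (measurable_of_countable (fun b : Bool => b = true)).comp (measurable_pi_apply e)

instance (n m : ℕ) (p q : I) : IsProbabilityMeasure (law n m p q) :=
  Measure.isProbabilityMeasure_map measurable_toGraph.aemeasurable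

/-- The 0-1 adjacency matrix `A` of a graph. -/
noncomputable def adj {n : ℕ} (G : SimpleGraph (Fin n)) : Matrix (Fin n) (Fin n) ℝ :=
  open Classical in G.adjMatrix ℝ

/-- The mean-field adjacency matrix: the block matrix with entries `q` on the `m × m` upper left
block and `p` elsewhere. -/
noncomputable def meanAdj (n m : ℕ) (p q : ℝ) : Matrix (Fin n) (Fin n) ℝ :=
  Matrix.of fun i j => if i.val < m ∧ j.val < m then q else p

/-- The random walk matrix `D⁻¹ A`, with `D` the diagonal matrix of the row sums of `A`
(a vanishing row sum gives a zero row). -/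
noncomputable def walk {n : ℕ} (A : Matrix (Fin n) (Fin n) ℝ) : Matrix (Fin n) (Fin n) ℝ :=
  Matrix.diagonal (fun i => (∑ j, A i j)⁻¹) * A

/-- The restart distribution: uniform on the `k` seeds `{0, …, k - 1}`. -/
noncomputable def restart (n k : ℕ) : Fin n → ℝ :=
  fun i => if i.val < k then 1 / (k : ℝ) else 0

/-- The row vector `(1 - α) ν [I - α D⁻¹ A]⁻¹`. -/
noncomputable def pageRank {n : ℕ} (α : ℝ) (k : ℕ) (A : Matrix (Fin n) (Fin n) ℝ) : Fin n → ℝ :=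
  (1 - α) • (restart n k ᵥ* (1 - α • walk A)⁻¹)

/-- The Euclidean norm of a vector. -/
noncomputable def l2norm {n : ℕ} (x : Fin n → ℝ) : ℝ := ‖WithLp.toLp 2 x‖

/-- The relative error `‖π - π̄‖₂ / ‖π̄‖₂` of the mean-field Personalized PageRank `π̄` with respect
to the Personalized PageRank `π` of the graph `G`. -/
noncomputable def relError {n : ℕ} (m k : ℕ) (p q α : ℝ) (G : SimpleGraph (Fin n)) : ℝ :=
  l2norm (pageRank α k (adj G) - pageRank α k (meanAdj n m p q)) /
    l2norm (pageRank α k (meanAdj n m p q))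

/-- The event `E n` holds asymptotically almost surely, i.e. its probability in the planted
random graph on `n` vertices tends to one. -/
def AAS (m : ℕ → ℕ) (p q : ℕ → I) (E : (n : ℕ) → SimpleGraph (Fin n) → Prop) : Prop :=
  Tendsto (fun n => law n (m n) (p n) (q n) {G | E n G}) atTop (𝓝 1)

end PlantedER

/-!
The proof rests on the resolvent identity `π - π̄ = α π̄ (P - P̄) [I - α P]⁻¹`
(`pageRank_sub_vecMul`), in which the random perturbation `P - P̄` acts on the deterministic row
vector `π̄`. So no bound on the operator norm of the random matrix `A - Ā` is needed, only a bound
on its action on one fixed vector, and that follows from second moments. Put `r = √(n q log n)`.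

* The factor `[I - α P]⁻¹` is controlled by the degrees alone: `P = D⁻¹ A` is a contraction in the
  Euclidean norm weighted by `1 / d`, hence `‖[I - α P]⁻¹‖ ≤ √(d_max / d_min) / (1 - α)`
  (`l2norm_le_vecMul_one_sub_walk`). This also gives invertibility.
* By a Chernoff bound (`measure_abs_sum_noise_ge_le`) with the variance proxy `n q`, all degrees
  are within `O(r)` of their means with probability at least `1 - 2 / n`. As `n p` and `n q` are of
  the same order, larger than `log n`, all degrees are then of order `n p`; in particular no vertex
  is isolated.
* With `y = π̄ D̄⁻¹` one has `π̄ (P - P̄) = y (A - Ā) + π̄ (D⁻¹ - D̄⁻¹) A`. The last term is bounded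
  by the degree deviations and Schur's test for `A` (`l2norm_vecMul_walk_sub_le`). The first has
  second moment at most `n q ‖y‖²`, up to the diagonal, so by Markov's inequality it exceeds
  `r ‖y‖` with probability at most `1 / log n` (`measure_l2norm_vecMul_noiseMatrix_gt_le`).

Together these give `(1 - α) √(n p / log n) ‖π - π̄‖ ≤ α C ‖π̄‖` with high probability, where
`C = 36 / c ^ 3` for any eventual lower bound `c` of `p / q`; see `l2norm_pageRank_sub_le` and
`law_not_goodGraph_le`. This is stronger than the bound with the denominator
`(1 - α) √(n p / log n) - α C`, which is positive for large `n`.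
-/

namespace PlantedER

/-! ### The Euclidean norm and Schur's test -/

lemma l2norm_sq {n : ℕ} (x : Fin n → ℝ) : l2norm x ^ 2 = ∑ i, x i ^ 2 := by
  simp [l2norm, EuclideanSpace.norm_sq_eq]

lemma l2norm_nonneg {n : ℕ} (x : Fin n → ℝ) : 0 ≤ l2norm x := norm_nonneg _

lemma l2norm_add_le {n : ℕ} (x y : Fin n → ℝ) : l2norm (x + y) ≤ l2norm x + l2norm y := by
  simpa only [l2norm, WithLp.toLp_add] using norm_add_le (WithLp.toLp 2 x) (WithLp.toLp 2 y)

lemma l2norm_smul {n : ℕ} (c : ℝ) (x : Fin n → ℝ) : l2norm (c • x) = |c| * l2norm x := by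
  simp [l2norm, WithLp.toLp_smul, norm_smul]

lemma l2norm_le_of_sum_sq_le {n : ℕ} {x : Fin n → ℝ} {c : ℝ} (hc : 0 ≤ c)
    (h : ∑ i, x i ^ 2 ≤ c ^ 2) : l2norm x ≤ c :=
  le_of_sq_le_sq (by rwa [l2norm_sq]) hc

lemma l2norm_le_mul {n : ℕ} {x y : Fin n → ℝ} {c : ℝ} (hc : 0 ≤ c)
    (h : ∀ i, |x i| ≤ c * |y i|) : l2norm x ≤ c * l2norm y := by
  refine l2norm_le_of_sum_sq_le (mul_nonneg hc (l2norm_nonneg y)) ?_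
  rw [mul_pow, l2norm_sq, Finset.mul_sum]
  refine Finset.sum_le_sum fun i _ => ?_
  rw [← sq_abs (x i), ← sq_abs (y i), ← mul_pow]
  exact pow_le_pow_left₀ (abs_nonneg _) (h i) 2

lemma l2norm_eq_zero {n : ℕ} {x : Fin n → ℝ} : l2norm x = 0 ↔ x = 0 := by
  simp [l2norm]

/-- Cauchy–Schwarz with the weights `A i j`, the pointwise step of Schur's test. -/
lemma sq_vecMul_le {n : ℕ} {A : Matrix (Fin n) (Fin n) ℝ} (hA : ∀ i j, 0 ≤ A i j)
    (hs : A.IsSymm) (z : Fin n → ℝ) (j : Fin n) :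
    (z ᵥ* A) j ^ 2 ≤ (∑ i, z i ^ 2 * A i j) * ∑ i, A j i := by
  have h := Finset.sum_sq_le_sum_mul_sum_of_sq_le_mul Finset.univ
    (r := fun i => z i * A i j) (f := fun i => z i ^ 2 * A i j) (g := fun i => A i j)
    (fun i _ => mul_nonneg (sq_nonneg _) (hA i j)) (fun i _ => hA i j)
    (fun i _ => (by ring : _ = _).le)
  simpa only [Matrix.vecMul, dotProduct, hs.apply] using h

/-- Schur's test for a symmetric nonnegative matrix. -/
lemma l2norm_vecMul_le {n : ℕ} {A : Matrix (Fin n) (Fin n) ℝ} (hA : ∀ i j, 0 ≤ A i j)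
    (hs : A.IsSymm) {b : ℝ} (hb : 0 ≤ b) (hd : ∀ i, ∑ j, A i j ≤ b) (z : Fin n → ℝ) :
    l2norm (z ᵥ* A) ≤ b * l2norm z := by
  refine l2norm_le_of_sum_sq_le (mul_nonneg hb (l2norm_nonneg z)) ?_
  calc ∑ j, (z ᵥ* A) j ^ 2 ≤ ∑ j, (∑ i, z i ^ 2 * A i j) * b :=
        Finset.sum_le_sum fun j _ => (sq_vecMul_le hA hs z j).trans <|
          mul_le_mul_of_nonneg_left (hd j) <|
            Finset.sum_nonneg fun i _ => mul_nonneg (sq_nonneg _) (hA i j)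
    _ = ∑ i, z i ^ 2 * (∑ j, A i j) * b := by
        rw [← Finset.sum_mul, Finset.sum_comm]
        simp only [Finset.mul_sum, Finset.sum_mul]
    _ ≤ ∑ i, z i ^ 2 * b * b := by
        gcongr with i
        exact hd i
    _ = (b * l2norm z) ^ 2 := by
        rw [mul_pow, l2norm_sq, ← Finset.sum_mul, ← Finset.sum_mul]
        ring

/-! ### Personalized PageRank of a symmetric nonnegative matrix -/

lemma vecMul_walk {n : ℕ} (A : Matrix (Fin n) (Fin n) ℝ) (z : Fin n → ℝ) :
    z ᵥ* walk A = (fun i => z i * (∑ j, A i j)⁻¹) ᵥ* A := by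
  rw [walk, ← Matrix.vecMul_vecMul]
  congr 1
  ext i
  simp [Matrix.vecMul_diagonal]

/-- The random walk matrix acts as a contraction on row vectors in the norm with weights `1 / d`,
where `d` is the vector of the degrees: it is conjugate to the symmetric matrix
`D^(-1/2) A D^(-1/2)`. -/
lemma l2norm_vecMul_walk_le {n : ℕ} {A : Matrix (Fin n) (Fin n) ℝ} (hA : ∀ i j, 0 ≤ A i j)
    (hs : A.IsSymm) (hd : ∀ i, 0 < ∑ j, A i j) (z : Fin n → ℝ) :
    l2norm (fun j => (z ᵥ* walk A) j / √(∑ l, A j l)) ≤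
      l2norm (fun j => z j / √(∑ l, A j l)) := by
  refine l2norm_le_of_sum_sq_le (l2norm_nonneg _) ?_
  rw [l2norm_sq, vecMul_walk]
  simp only [div_pow, Real.sq_sqrt (hd _).le]
  calc ∑ j, ((fun i => z i * (∑ l, A i l)⁻¹) ᵥ* A) j ^ 2 / ∑ l, A j l
      ≤ ∑ j, ∑ i, (z i * (∑ l, A i l)⁻¹) ^ 2 * A i j :=
        Finset.sum_le_sum fun j _ => (div_le_iff₀ (hd j)).2 (sq_vecMul_le hA hs _ j)
    _ = ∑ i, z i ^ 2 / ∑ l, A i l := by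
        rw [Finset.sum_comm]
        refine Finset.sum_congr rfl fun i _ => ?_
        rw [← Finset.mul_sum]
        have := (hd i).ne'
        field_simp

/-- The norm of `[I - α D⁻¹ A]⁻¹` is at most `√(b / a) / (1 - α)` if all degrees lie
in `[a, b]`. -/
lemma l2norm_le_vecMul_one_sub_walk {n : ℕ} {A : Matrix (Fin n) (Fin n) ℝ}
    (hA : ∀ i j, 0 ≤ A i j) (hs : A.IsSymm) {a b : ℝ} (ha : 0 < a)
    (hda : ∀ i, a ≤ ∑ j, A i j) (hdb : ∀ i, ∑ j, A i j ≤ b) {α : ℝ} (hα : 0 ≤ α) (hα1 : α < 1)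
    (z : Fin n → ℝ) :
    (1 - α) * l2norm z ≤ √(b / a) * l2norm (z ᵥ* (1 - α • walk A)) := by
  have hd : ∀ i, 0 < ∑ j, A i j := fun i => ha.trans_le (hda i)
  set w := z ᵥ* (1 - α • walk A) with hw
  -- the weighted norm
  let N : (Fin n → ℝ) → ℝ := fun x => l2norm (fun j => x j / √(∑ l, A j l))
  have hzw : z = w + α • (z ᵥ* walk A) := by
    rw [hw, Matrix.vecMul_sub, Matrix.vecMul_one, Matrix.vecMul_smul, sub_add_cancel]
  have h1 : N z ≤ N w + α * N z := by
    have h2 : (fun j => z j / √(∑ l, A j l)) = (fun j => w j / √(∑ l, A j l)) +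
        α • (fun j => (z ᵥ* walk A) j / √(∑ l, A j l)) := by
      ext j
      have := congrFun hzw j
      simp only [Pi.add_apply, Pi.smul_apply, smul_eq_mul] at this ⊢
      rw [← mul_div_assoc, ← add_div, ← this]
    calc N z ≤ N w + l2norm (α • (fun j => (z ᵥ* walk A) j / √(∑ l, A j l))) := by
          simp only [N]
          rw [h2]
          exact l2norm_add_le _ _
      _ ≤ N w + α * N z := by
          rw [l2norm_smul, abs_of_nonneg hα]
          gcongr
          exact l2norm_vecMul_walk_le hA hs hd z
  rcases isEmpty_or_nonempty (Fin n) with hn | ⟨⟨i₀⟩⟩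
  · simp [l2norm, Subsingleton.elim z 0, Subsingleton.elim w 0]
  have hb : 0 < b := (hd i₀).trans_le (hdb i₀)
  have hz : l2norm z ≤ √b * N z := by
    refine l2norm_le_mul (Real.sqrt_nonneg b) fun j => ?_
    rw [abs_div, abs_of_pos (Real.sqrt_pos.2 (hd j)), mul_div_assoc',
      le_div_iff₀ (Real.sqrt_pos.2 (hd j)), mul_comm]
    gcongr
    exact hdb j
  have hNw : N w ≤ (√a)⁻¹ * l2norm w := by
    refine l2norm_le_mul (by positivity) fun j => ?_
    rw [abs_div, abs_of_pos (Real.sqrt_pos.2 (hd j)), div_eq_inv_mul]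
    gcongr
    exact hda j
  calc (1 - α) * l2norm z ≤ (1 - α) * (√b * N z) :=
        mul_le_mul_of_nonneg_left hz (by linarith)
    _ = √b * (N z - α * N z) := by ring
    _ ≤ √b * ((√a)⁻¹ * l2norm w) := by
        gcongr
        linarith
    _ = √(b / a) * l2norm w := by
        rw [Real.sqrt_div hb.le, div_eq_mul_inv]
        ring

lemma isUnit_one_sub_walk {n : ℕ} {A : Matrix (Fin n) (Fin n) ℝ} (hA : ∀ i j, 0 ≤ A i j)
    (hs : A.IsSymm) {a b : ℝ} (ha : 0 < a) (hda : ∀ i, a ≤ ∑ j, A i j)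
    (hdb : ∀ i, ∑ j, A i j ≤ b) {α : ℝ} (hα : 0 ≤ α) (hα1 : α < 1) :
    IsUnit (1 - α • walk A) := by
  rw [← Matrix.vecMul_injective_iff_isUnit]
  intro x y (hxy : x ᵥ* _ = y ᵥ* _)
  have h := l2norm_le_vecMul_one_sub_walk hA hs ha hda hdb hα hα1 (x - y)
  rw [Matrix.sub_vecMul, hxy, sub_self, l2norm_eq_zero.2 rfl, mul_zero] at h
  have h0 : l2norm (x - y) = 0 :=
    le_antisymm (nonpos_of_mul_nonpos_right h (by linarith)) (l2norm_nonneg _)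
  exact sub_eq_zero.1 (l2norm_eq_zero.1 h0)

lemma pageRank_vecMul {n : ℕ} {A : Matrix (Fin n) (Fin n) ℝ} {α : ℝ} (k : ℕ)
    (h : IsUnit (1 - α • walk A)) :
    pageRank α k A ᵥ* (1 - α • walk A) = (1 - α) • restart n k := by
  rw [pageRank, Matrix.smul_vecMul, Matrix.vecMul_vecMul,
    Matrix.nonsing_inv_mul _ ((Matrix.isUnit_iff_isUnit_det _).1 h), Matrix.vecMul_one]

/-- The resolvent identity `π - π̄ = α π̄ (P - P̄) [I - α P]⁻¹`. It puts the perturbation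
`P - P̄` next to the vector `π̄`, which is deterministic in the application. -/
lemma pageRank_sub_vecMul {n : ℕ} {A B : Matrix (Fin n) (Fin n) ℝ} {α : ℝ} (k : ℕ)
    (hA : IsUnit (1 - α • walk A)) (hB : IsUnit (1 - α • walk B)) :
    (pageRank α k A - pageRank α k B) ᵥ* (1 - α • walk A) =
      α • (pageRank α k B ᵥ* (walk A - walk B)) := by
  have h : pageRank α k B ᵥ* (1 - α • walk A) =
      pageRank α k B ᵥ* (1 - α • walk B) - α • (pageRank α k B ᵥ* (walk A - walk B)) := by
    simp only [Matrix.vecMul_sub, Matrix.vecMul_smul, smul_sub]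
    abel
  rw [Matrix.sub_vecMul, h, pageRank_vecMul k hA, pageRank_vecMul k hB, sub_sub_cancel]

/-- Deterministic bound on `x (P - P̄)` from the deviation `t` of the degrees and the size `s` of
the action of `A - Ā` on the single vector `x D̄⁻¹`. -/
lemma l2norm_vecMul_walk_sub_le {n : ℕ} {A B : Matrix (Fin n) (Fin n) ℝ}
    (hA : ∀ i j, 0 ≤ A i j) (hs : A.IsSymm) {a b t s : ℝ} (ha : 0 < a) (hb : 0 ≤ b) (ht : 0 ≤ t)
    (hta : t ≤ a / 2) (htb : t ≤ b)
    (hda : ∀ i, a ≤ ∑ j, B i j) (hdb : ∀ i, ∑ j, B i j ≤ b)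
    (hdev : ∀ i, |∑ j, A i j - ∑ j, B i j| ≤ t) (hs0 : 0 ≤ s) (x : Fin n → ℝ)
    (hx : l2norm ((fun i => x i * (∑ j, B i j)⁻¹) ᵥ* (A - B)) ≤
      s * l2norm (fun i => x i * (∑ j, B i j)⁻¹)) :
    l2norm (x ᵥ* (walk A - walk B)) ≤ (s / a + 2 * b * (2 * t / a ^ 2)) * l2norm x := by
  set y : Fin n → ℝ := fun i => x i * (∑ j, B i j)⁻¹ with hy
  set u : Fin n → ℝ := fun i => x i * ((∑ j, A i j)⁻¹ - (∑ j, B i j)⁻¹) with hu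
  have hsplit : x ᵥ* (walk A - walk B) = y ᵥ* (A - B) + u ᵥ* A := by
    have hxu : (fun i => x i * (∑ j, A i j)⁻¹) = y + u := by
      ext i
      simp only [hy, hu, Pi.add_apply]
      ring
    rw [Matrix.vecMul_sub, vecMul_walk, vecMul_walk, hxu, Matrix.add_vecMul, Matrix.vecMul_sub]
    abel
  have hyx : l2norm y ≤ a⁻¹ * l2norm x := by
    refine l2norm_le_mul (by positivity) fun i => ?_
    rw [hy, abs_mul, mul_comm, abs_of_pos (inv_pos.2 (ha.trans_le (hda i)))]
    gcongr
    exact hda i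
  have hux : l2norm u ≤ 2 * t / a ^ 2 * l2norm x := by
    refine l2norm_le_mul (by positivity) fun i => ?_
    have hB : 0 < ∑ j, B i j := ha.trans_le (hda i)
    have hA2 : a / 2 ≤ ∑ j, A i j := by linarith [(abs_le.1 (hdev i)).1, hda i]
    have hA0 : 0 < ∑ j, A i j := by linarith
    rw [hu, abs_mul, mul_comm, inv_sub_inv hA0.ne' hB.ne', abs_div, abs_of_pos (mul_pos hA0 hB)]
    refine mul_le_mul_of_nonneg_right ?_ (abs_nonneg _)
    calc |∑ j, B i j - ∑ j, A i j| / ((∑ j, A i j) * ∑ j, B i j) ≤ t / (a / 2 * a) := by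
          rw [abs_sub_comm]
          gcongr
          · exact hdev i
          · exact hda i
      _ = 2 * t / a ^ 2 := by field_simp
  have huA : l2norm (u ᵥ* A) ≤ 2 * b * l2norm u :=
    l2norm_vecMul_le hA hs (by positivity)
      (fun i => by linarith [(abs_le.1 (hdev i)).2, hdb i]) u
  calc l2norm (x ᵥ* (walk A - walk B)) ≤ l2norm (y ᵥ* (A - B)) + l2norm (u ᵥ* A) := by
        rw [hsplit]
        exact l2norm_add_le _ _
    _ ≤ s * (a⁻¹ * l2norm x) + 2 * b * (2 * t / a ^ 2 * l2norm x) := by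
        gcongr
        · exact hx.trans (by gcongr)
        · exact huA.trans (by gcongr)
    _ = (s / a + 2 * b * (2 * t / a ^ 2)) * l2norm x := by
        rw [div_eq_mul_inv s a]
        ring

/-! ### Concentration of the coins -/

/-- The joint law of the coins, one for each unordered pair of vertices, the loops included;
`law` is its image under `toGraph`. -/
noncomputable abbrev coinLaw (n m : ℕ) (p q : I) : Measure (Sym2 (Fin n) → Bool) :=
  Measure.pi fun e => bernoulliMeasure true false (edgeProb m p q e)

/-- The centred indicator of the edge `e`. -/
noncomputable def noise {n : ℕ} (m : ℕ) (p q : I) (e : Sym2 (Fin n))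
    (ω : Sym2 (Fin n) → Bool) : ℝ :=
  (if ω e = true then 1 else 0) - (edgeProb m p q e : ℝ)

/-- The symmetric matrix of centred indicators. The coins on the loops are kept, so that each
row consists of `n` independent entries and the expectation of the uncentred matrix is exactly
`meanAdj`. -/
noncomputable def noiseMatrix {n : ℕ} (m : ℕ) (p q : I) (ω : Sym2 (Fin n) → Bool) :
    Matrix (Fin n) (Fin n) ℝ :=
  Matrix.of fun i j => noise m p q s(i, j) ω

lemma edgeProb_le {n m : ℕ} {p q : I} (hpq : p ≤ q) (e : Sym2 (Fin n)) :
    (edgeProb m p q e : ℝ) ≤ q := by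
  unfold edgeProb
  split_ifs
  · exact le_rfl
  · exact_mod_cast hpq

lemma integral_coinLaw {n m : ℕ} {p q : I} (e : Sym2 (Fin n)) (f : Bool → ℝ) :
    ∫ ω, f (ω e) ∂coinLaw n m p q =
      edgeProb m p q e * f true + (1 - edgeProb m p q e) * f false := by
  have h := (measurePreserving_eval
    (fun e : Sym2 (Fin n) => bernoulliMeasure true false (edgeProb m p q e)) e).map_eq
  have h2 := integral_bernoulliMeasure true false (edgeProb m p q e) f
  rw [← h, integral_map (measurable_pi_apply e).aemeasurable
    (measurable_of_countable f).aestronglyMeasurable] at h2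
  simpa using h2

lemma integral_noise {n m : ℕ} {p q : I} (e : Sym2 (Fin n)) :
    ∫ ω, noise m p q e ω ∂coinLaw n m p q = 0 := by
  refine (integral_coinLaw e fun b => (if b = true then 1 else 0) - (edgeProb m p q e : ℝ)).trans ?_
  simp
  ring

lemma integral_noise_sq_le {n m : ℕ} {p q : I} (hpq : p ≤ q) (e : Sym2 (Fin n)) :
    ∫ ω, noise m p q e ω ^ 2 ∂coinLaw n m p q ≤ q := by
  refine (integral_coinLaw e
    fun b => ((if b = true then 1 else 0) - (edgeProb m p q e : ℝ)) ^ 2).trans_le ?_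
  have h := edgeProb_le (m := m) hpq e
  have h0 := (edgeProb m p q e).2.1
  have h1 := (edgeProb m p q e).2.2
  simp
  nlinarith

lemma mgf_noise_le {n m : ℕ} {p q : I} (hpq : p ≤ q) (e : Sym2 (Fin n)) {s : ℝ} (hs : |s| ≤ 1) :
    mgf (noise m p q e) (coinLaw n m p q) s ≤ Real.exp (q * s ^ 2) := by
  have hE := edgeProb_le (m := m) hpq e
  have h0 := (edgeProb m p q e).2.1
  set P : ℝ := (edgeProb m p q e : ℝ) with hP
  have h1 : mgf (noise m p q e) (coinLaw n m p q) s =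
      P * Real.exp (s * (1 - P)) + (1 - P) * Real.exp (s * (0 - P)) :=
    (integral_coinLaw e fun b => Real.exp (s * ((if b = true then 1 else 0) - P))).trans (by simp [P])
  have h2 : Real.exp s - 1 ≤ s + s ^ 2 := by
    linarith [(abs_le.1 (Real.abs_exp_sub_one_sub_id_le hs)).2]
  calc mgf (noise m p q e) (coinLaw n m p q) s
      = Real.exp (-(s * P)) * (P * (Real.exp s - 1) + 1) := by
        rw [h1, show s * (1 - P) = -(s * P) + s by ring, show s * (0 - P) = -(s * P) by ring,
          Real.exp_add]
        ring
    _ ≤ Real.exp (-(s * P)) * Real.exp (P * (s + s ^ 2)) := by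
        gcongr
        exact (Real.add_one_le_exp _).trans (Real.exp_le_exp.2 (by gcongr))
    _ = Real.exp (P * s ^ 2) := by
        rw [← Real.exp_add]
        ring_nf
    _ ≤ Real.exp (q * s ^ 2) := by gcongr

/-- The entries of a row of the noise matrix are independent. -/
lemma iIndepFun_noise {n : ℕ} (m : ℕ) (p q : I) (i : Fin n) :
    iIndepFun (fun j : Fin n => noise m p q s(i, j)) (coinLaw n m p q) := by
  have h : iIndepFun (fun e : Sym2 (Fin n) => noise m p q e) (coinLaw n m p q) :=
    iIndepFun_pi (X := fun e (b : Bool) => (if b = true then 1 else 0) - (edgeProb m p q e : ℝ))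
      fun e => (measurable_of_countable _).aemeasurable
  exact h.precomp (g := fun j => s(i, j)) fun j l hjl => Sym2.congr_right.1 hjl

lemma mgf_sum_noise_le {n m : ℕ} {p q : I} (hpq : p ≤ q) (i : Fin n) {s : ℝ}
    (hs : |s| ≤ 1) :
    mgf (∑ j, noise m p q s(i, j)) (coinLaw n m p q) s ≤ Real.exp (n * q * s ^ 2) := by
  rw [(iIndepFun_noise m p q i).mgf_sum (fun j => measurable_of_countable _)]
  calc ∏ j, mgf (noise m p q s(i, j)) (coinLaw n m p q) s
      ≤ ∏ _j : Fin n, Real.exp (q * s ^ 2) :=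
        Finset.prod_le_prod (fun j _ => mgf_nonneg) fun j _ => mgf_noise_le hpq _ hs
    _ = Real.exp (n * q * s ^ 2) := by
        rw [Finset.prod_const, Finset.card_univ, Fintype.card_fin, ← Real.exp_nat_mul, mul_assoc]

/-- The two-sided Chernoff bound for the degree of a vertex. -/
lemma measure_abs_sum_noise_ge_le {n m : ℕ} {p q : I} (hpq : p ≤ q) (i : Fin n) {s : ℝ}
    (hs : 0 ≤ s) (hs1 : s ≤ 1) (t : ℝ) :
    (coinLaw n m p q).real {ω | t ≤ |∑ j, noiseMatrix m p q ω i j|} ≤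
      2 * Real.exp (-(s * t) + n * q * s ^ 2) := by
  have key := measure_ge_le_exp_mul_mgf (μ := coinLaw n m p q)
    (X := ∑ j, noise m p q s(i, j)) t hs .of_finite
  have key2 := measure_le_le_exp_mul_mgf (μ := coinLaw n m p q)
    (X := ∑ j, noise m p q s(i, j)) (-t) (neg_nonpos.2 hs) .of_finite
  have h1 := mgf_sum_noise_le (m := m) hpq i (s := s) (by rwa [abs_of_nonneg hs])
  have h2 := mgf_sum_noise_le (m := m) hpq i (s := -s) (by rwa [abs_neg, abs_of_nonneg hs])
  have hsub : {ω | t ≤ |∑ j, noiseMatrix m p q ω i j|} ⊆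
      {ω | t ≤ (∑ j, noise m p q s(i, j)) ω} ∪ {ω | (∑ j, noise m p q s(i, j)) ω ≤ -t} := by
    intro ω hω
    have hω' : t ≤ |(∑ j, noise m p q s(i, j)) ω| := by simpa [noiseMatrix] using hω
    rcases le_abs.1 hω' with h | h
    · exact Or.inl h
    · exact Or.inr (le_neg.1 h)
  calc _ ≤ _ := measureReal_mono hsub
    _ ≤ _ := measureReal_union_le _ _
    _ ≤ Real.exp (-s * t) * Real.exp (n * q * s ^ 2) +
        Real.exp (- -s * -t) * Real.exp (n * q * (-s) ^ 2) := by
        refine add_le_add (key.trans ?_) (key2.trans ?_)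
        · gcongr
        · gcongr
    _ = 2 * Real.exp (-(s * t) + n * q * s ^ 2) := by
        rw [Real.exp_add]
        ring_nf

/-- Second moment bound for the noise matrix acting on a fixed vector. -/
lemma integral_sum_vecMul_noiseMatrix_sq_le {n m : ℕ} {p q : I} (hpq : p ≤ q) (y : Fin n → ℝ) :
    ∫ ω, l2norm (y ᵥ* noiseMatrix m p q ω) ^ 2 ∂coinLaw n m p q ≤ n * q * l2norm y ^ 2 := by
  have hcol : ∀ j, ∫ ω, (y ᵥ* noiseMatrix m p q ω) j ^ 2 ∂coinLaw n m p q ≤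
      q * l2norm y ^ 2 := by
    intro j
    let X : Fin n → (Sym2 (Fin n) → Bool) → ℝ := fun i ω => y i * noise m p q s(j, i) ω
    have hX : ∀ i, MemLp (X i) 2 (coinLaw n m p q) := fun i => MemLp.of_discrete
    have hX0 : ∀ i, ∫ ω, X i ω ∂coinLaw n m p q = 0 := fun i => by
      simp only [X]
      rw [integral_const_mul, integral_noise, mul_zero]
    have hind : iIndepFun X (coinLaw n m p q) :=
      (iIndepFun_noise m p q j).comp (fun i x => y i * x) fun i => measurable_const_mul (y i)
    have hsum := IndepFun.variance_sum (s := Finset.univ) (fun i _ => hX i)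
      fun a _ b _ hab => hind.indepFun hab
    have hS0 : ∫ ω, (∑ i, X i) ω ∂coinLaw n m p q = 0 := by
      simp only [Finset.sum_apply]
      rw [integral_finsetSum _ fun i _ => .of_finite]
      exact Finset.sum_eq_zero fun i _ => hX0 i
    rw [variance_of_integral_eq_zero (measurable_of_countable _).aemeasurable hS0] at hsum
    calc ∫ ω, (y ᵥ* noiseMatrix m p q ω) j ^ 2 ∂coinLaw n m p q
        = ∫ ω, (∑ i, X i) ω ^ 2 ∂coinLaw n m p q := by
          simp [X, Matrix.vecMul, dotProduct, noiseMatrix, Sym2.eq_swap]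
      _ = ∑ i, variance (X i) (coinLaw n m p q) := hsum
      _ ≤ ∑ i, q * y i ^ 2 := by
          refine Finset.sum_le_sum fun i _ => ?_
          rw [variance_of_integral_eq_zero (measurable_of_countable _).aemeasurable (hX0 i)]
          simp only [X, mul_pow]
          rw [integral_const_mul, mul_comm]
          gcongr
          exact integral_noise_sq_le hpq _
      _ = q * l2norm y ^ 2 := by rw [← Finset.mul_sum, l2norm_sq]
  simp only [l2norm_sq (_ ᵥ* _)]
  rw [integral_finsetSum _ fun i _ => .of_finite]
  refine (Finset.sum_le_sum fun j _ => hcol j).trans_eq ?_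
  rw [Finset.sum_const, Finset.card_univ, Fintype.card_fin, nsmul_eq_mul, mul_assoc]

/-- Markov's inequality for the noise matrix acting on a fixed vector. -/
lemma measure_l2norm_vecMul_noiseMatrix_gt_le {n m : ℕ} {p q : I} (hpq : p ≤ q)
    (y : Fin n → ℝ) {r : ℝ} (hr : 0 < r) :
    (coinLaw n m p q).real {ω | r * l2norm y < l2norm (y ᵥ* noiseMatrix m p q ω)} ≤
      n * q / r ^ 2 := by
  rcases eq_or_ne y 0 with rfl | hy
  · have h0 : l2norm (0 : Fin n → ℝ) = 0 := l2norm_eq_zero.2 rfl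
    have hq0 := q.2.1
    simp only [Matrix.zero_vecMul, h0, mul_zero, lt_irrefl, Set.ofPred_false, measureReal_empty]
    positivity
  have hy0 : 0 < l2norm y :=
    lt_of_le_of_ne (l2norm_nonneg y) fun h => hy (l2norm_eq_zero.1 h.symm)
  have h := mul_meas_ge_le_integral_of_nonneg (μ := coinLaw n m p q)
    (f := fun ω => l2norm (y ᵥ* noiseMatrix m p q ω) ^ 2) (ae_of_all _ fun ω => sq_nonneg _)
    .of_finite ((r * l2norm y) ^ 2)
  have hsub : {ω | r * l2norm y < l2norm (y ᵥ* noiseMatrix m p q ω)} ⊆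
      {ω | (r * l2norm y) ^ 2 ≤ l2norm (y ᵥ* noiseMatrix m p q ω) ^ 2} := fun ω hω =>
    pow_le_pow_left₀ (mul_nonneg hr.le hy0.le) (le_of_lt (Set.mem_ofPred.1 hω)) 2
  have h2 := (mul_le_mul_of_nonneg_left (measureReal_mono hsub) (sq_nonneg (r * l2norm y))).trans
    (h.trans (integral_sum_vecMul_noiseMatrix_sq_le hpq y))
  rw [le_div_iff₀ (by positivity)]
  refine le_of_mul_le_mul_right ?_ (pow_pos hy0 2)
  refine le_of_eq_of_le ?_ h2
  ring

/-! ### The relative error on the good event -/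

open Classical in
lemma adj_apply {n : ℕ} (G : SimpleGraph (Fin n)) (i j : Fin n) :
    adj G i j = if G.Adj i j then 1 else 0 := by
  simp [adj, SimpleGraph.adjMatrix_apply]

lemma adj_nonneg {n : ℕ} (G : SimpleGraph (Fin n)) (i j : Fin n) : 0 ≤ adj G i j := by
  rw [adj_apply]
  split_ifs <;> norm_num

lemma adj_isSymm {n : ℕ} (G : SimpleGraph (Fin n)) : (adj G).IsSymm := by
  classical
  ext i j
  rw [Matrix.transpose_apply, adj_apply, adj_apply]
  exact if_congr (G.adj_comm j i) rfl rfl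

lemma exists_adj_of_sum_pos {n : ℕ} {G : SimpleGraph (Fin n)} {i : Fin n}
    (h : 0 < ∑ j, adj G i j) : ∃ j, G.Adj i j := by
  by_contra! hG
  refine h.ne' (Finset.sum_eq_zero fun j _ => ?_)
  simp [adj_apply, hG j]

lemma meanAdj_isSymm (n m : ℕ) (p q : ℝ) : (meanAdj n m p q).IsSymm := by
  ext i j
  simp [meanAdj, and_comm]

lemma le_meanAdj {n m : ℕ} {p q : ℝ} (h : p ≤ q) (i j : Fin n) : p ≤ meanAdj n m p q i j := by
  simp only [meanAdj, Matrix.of_apply]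
  split_ifs <;> simp [h]

lemma meanAdj_le {n m : ℕ} {p q : ℝ} (h : p ≤ q) (i j : Fin n) : meanAdj n m p q i j ≤ q := by
  simp only [meanAdj, Matrix.of_apply]
  split_ifs <;> simp [h]

lemma mul_le_sum_meanAdj {n m : ℕ} {p q : ℝ} (h : p ≤ q) (i : Fin n) :
    n * p ≤ ∑ j, meanAdj n m p q i j := by
  simpa using Finset.card_nsmul_le_sum Finset.univ (meanAdj n m p q i) p fun j _ => le_meanAdj h i j

lemma sum_meanAdj_le_mul {n m : ℕ} {p q : ℝ} (h : p ≤ q) (i : Fin n) :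
    ∑ j, meanAdj n m p q i j ≤ n * q := by
  simpa using Finset.sum_le_card_nsmul Finset.univ (meanAdj n m p q i) q fun j _ => meanAdj_le h i j

/-- The adjacency matrix differs from its mean field by the noise matrix and by the diagonal
matrix of the coins on the loops. -/
lemma adj_sub_meanAdj {n : ℕ} (m : ℕ) (p q : I) (ω : Sym2 (Fin n) → Bool) :
    adj (toGraph ω) - meanAdj n m p q =
      noiseMatrix m p q ω - Matrix.diagonal fun i => if ω s(i, i) = true then (1 : ℝ) else 0 := by
  classical
  ext i j
  have hE : (edgeProb m p q s(i, j) : ℝ) = meanAdj n m p q i j := by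
    simp only [edgeProb, meanAdj, Sym2.mem_iff, forall_eq_or_imp, forall_eq, Matrix.of_apply]
    split_ifs <;> rfl
  simp only [Matrix.sub_apply, noiseMatrix, noise, Matrix.of_apply, hE, adj_apply,
    toGraph, SimpleGraph.fromEdgeSet_adj]
  by_cases hij : i = j
  · subst hij
    simp
  · simp [hij]

/-- Bound on the relative error on the event that all degrees are within `3 √(n q log n)` of their means
(up to the loops) and the noise matrix stretches the vector `π̄ D̄⁻¹` by a factor of at most
`√(n q log n)`. The three uses of `p / q ≥ c` cost a factor `c⁻¹` each. -/
lemma l2norm_pageRank_sub_le {n m k : ℕ} {p q : I} {c L α : ℝ} {ω : Sym2 (Fin n) → Bool}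
    (hn : 0 < n) (hc : 0 < c) (hpq : p ≤ q) (hq : 0 < (q : ℝ)) (hcq : c * q ≤ p) (hL : 1 ≤ L)
    (hLq : 64 * L ≤ c ^ 2 * (n * q)) (hα : 0 ≤ α) (hα1 : α < 1)
    (hdeg : ∀ i, |∑ j, noiseMatrix m p q ω i j| ≤ 3 * √(n * q * L))
    (hvec : l2norm ((fun i => pageRank α k (meanAdj n m p q) i *
        (∑ j, meanAdj n m p q i j)⁻¹) ᵥ* noiseMatrix m p q ω) ≤
      √(n * q * L) * l2norm (fun i => pageRank α k (meanAdj n m p q) i *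
        (∑ j, meanAdj n m p q i j)⁻¹)) :
    (∀ i, ∃ j, (toGraph ω).Adj i j) ∧
      (1 - α) * √(n * p / L) *
          l2norm (pageRank α k (adj (toGraph ω)) - pageRank α k (meanAdj n m p q)) ≤
        α * (36 / c ^ 3) * l2norm (pageRank α k (meanAdj n m p q)) := by
  have hpq' : (p : ℝ) ≤ q := by exact_mod_cast hpq
  have hn' : (0 : ℝ) < n := by exact_mod_cast hn
  have hp : 0 < (p : ℝ) := (mul_pos hc hq).trans_le hcq
  set A := adj (toGraph ω) with hA
  set B := meanAdj n m p q with hB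
  set x := pageRank α k B with hx
  set a : ℝ := n * p with ha
  set b : ℝ := n * q with hb
  have ha0 : 0 < a := mul_pos hn' hp
  have hb0 : 0 < b := mul_pos hn' hq
  have hab : a ≤ b := mul_le_mul_of_nonneg_left hpq' hn'.le
  have hcab : c * b ≤ a := by
    calc c * b = n * (c * q) := by rw [hb]; ring
      _ ≤ a := mul_le_mul_of_nonneg_left hcq hn'.le
  have hc1 : c ≤ 1 := le_of_mul_le_mul_right (by linarith) hb0
  have hb1 : 1 ≤ b := by nlinarith
  set r : ℝ := √(b * L) with hr
  have hr1 : 1 ≤ r := Real.one_le_sqrt.2 (one_le_mul_of_one_le_of_one_le hb1 hL)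
  have hra : 4 * r ≤ a / 2 := by
    have h : r ≤ c * b / 8 := Real.sqrt_le_iff.2 ⟨by positivity, by nlinarith⟩
    linarith
  have hba : b / a ≤ c⁻¹ := by
    rw [div_le_iff₀ ha0, inv_mul_eq_div, le_div_iff₀ hc, mul_comm]
    exact hcab
  have hBpos : ∀ i j, 0 ≤ B i j := fun i j => hp.le.trans (le_meanAdj hpq' i j)
  have hda : ∀ i, a ≤ ∑ j, B i j := mul_le_sum_meanAdj hpq'
  have hdb : ∀ i, ∑ j, B i j ≤ b := sum_meanAdj_le_mul hpq'
  have hloop : ∀ i, |if ω s(i, i) = true then (1 : ℝ) else 0| ≤ 1 := fun i => by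
    split_ifs <;> simp
  have hAB := adj_sub_meanAdj m p q ω
  have hdev : ∀ i, |∑ j, A i j - ∑ j, B i j| ≤ 4 * r := by
    intro i
    have h : ∑ j, A i j - ∑ j, B i j =
        ∑ j, noiseMatrix m p q ω i j - if ω s(i, i) = true then (1 : ℝ) else 0 := by
      have h2 := congrArg (fun M : Matrix (Fin n) (Fin n) ℝ => ∑ j, M i j) hAB
      simpa [Matrix.sub_apply, Finset.sum_sub_distrib, Matrix.diagonal_apply] using h2
    rw [h]
    exact (abs_sub _ _).trans (by linarith [hdeg i, hloop i])
  set y : Fin n → ℝ := fun i => x i * (∑ j, B i j)⁻¹ with hy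
  have hvec2 : l2norm (y ᵥ* (A - B)) ≤ 2 * r * l2norm y := by
    rw [hAB, Matrix.vecMul_sub, sub_eq_add_neg]
    have h1 : l2norm (-(y ᵥ* Matrix.diagonal fun i => if ω s(i, i) = true then (1 : ℝ) else 0)) ≤
        1 * l2norm y := by
      refine l2norm_le_mul zero_le_one fun i => ?_
      rw [Pi.neg_apply, abs_neg, Matrix.vecMul_diagonal, abs_mul, mul_comm]
      exact mul_le_mul_of_nonneg_right (hloop i) (abs_nonneg _)
    have h2 := l2norm_nonneg y
    refine (l2norm_add_le _ _).trans ((add_le_add hvec h1).trans ?_)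
    nlinarith
  have hA2 : ∀ i, a / 2 ≤ ∑ j, A i j := fun i => by linarith [(abs_le.1 (hdev i)).1, hda i]
  have hAb : ∀ i, ∑ j, A i j ≤ 2 * b := fun i => by linarith [(abs_le.1 (hdev i)).2, hdb i]
  have hA0 : ∀ i j, 0 ≤ A i j := adj_nonneg _
  have hAs : A.IsSymm := adj_isSymm _
  refine ⟨fun i => exists_adj_of_sum_pos (lt_of_lt_of_le (half_pos ha0) (hA2 i)), ?_⟩
  have hUA := isUnit_one_sub_walk hA0 hAs (half_pos ha0) hA2 hAb hα hα1
  have hUB := isUnit_one_sub_walk hBpos (meanAdj_isSymm n m p q) ha0 hda hdb hα hα1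
  have hpert := l2norm_vecMul_walk_sub_le hA0 hAs ha0 hb0.le (by positivity) hra
    (by linarith) hda hdb hdev (by positivity) x hvec2
  have hres := l2norm_le_vecMul_one_sub_walk hA0 hAs (half_pos ha0) hA2 hAb hα hα1
    (pageRank α k A - x)
  rw [pageRank_sub_vecMul k hUA hUB, l2norm_smul, abs_of_nonneg hα] at hres
  have hK : √(2 * b / (a / 2)) ≤ 2 / c := by
    refine Real.sqrt_le_iff.2 ⟨by positivity, ?_⟩
    have hinv : c⁻¹ ≤ c⁻¹ * c⁻¹ := le_mul_of_one_le_left (by positivity) ((one_le_inv₀ hc).2 hc1)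
    calc 2 * b / (a / 2) = 4 * (b / a) := by field_simp; norm_num
      _ ≤ 4 * (c⁻¹ * c⁻¹) := by linarith
      _ = (2 / c) ^ 2 := by field_simp; norm_num
  -- the scale of the perturbation: `√(n q log n) / (n p)` times `√(n p / log n)`
  have hS : √(a / L) * (r / a) ≤ c⁻¹ := by
    have h : √(a / L) * r = √(a * b) := by
      rw [hr, ← Real.sqrt_mul (by positivity)]
      congr 1
      field_simp
    rw [← mul_div_assoc, h]
    calc √(a * b) / a ≤ √(b * b) / a := by gcongr
      _ = b / a := by rw [Real.sqrt_mul_self hb0.le]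
      _ ≤ c⁻¹ := hba
  have hfac : √(a / L) * (2 * r / a + 2 * b * (2 * (4 * r) / a ^ 2)) ≤ 18 / c ^ 2 := by
    have hinv : 1 ≤ c⁻¹ := (one_le_inv₀ hc).2 hc1
    calc √(a / L) * (2 * r / a + 2 * b * (2 * (4 * r) / a ^ 2))
        = √(a / L) * (r / a) * (2 + 16 * (b / a)) := by field_simp; ring
      _ ≤ c⁻¹ * (2 * c⁻¹ + 16 * c⁻¹) := by
          gcongr
          linarith
      _ = 18 / c ^ 2 := by field_simp; norm_num
  calc (1 - α) * √(a / L) * l2norm (pageRank α k A - x)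
      = √(a / L) * ((1 - α) * l2norm (pageRank α k A - x)) := by ring
    _ ≤ √(a / L) * (2 / c * (α * ((2 * r / a + 2 * b * (2 * (4 * r) / a ^ 2)) * l2norm x))) := by
        refine mul_le_mul_of_nonneg_left (hres.trans ?_) (Real.sqrt_nonneg _)
        have := l2norm_nonneg (x ᵥ* (walk A - walk B))
        gcongr
    _ = 2 / c * α * l2norm x * (√(a / L) * (2 * r / a + 2 * b * (2 * (4 * r) / a ^ 2))) := by ring
    _ ≤ 2 / c * α * l2norm x * (18 / c ^ 2) := by
        have := l2norm_nonneg x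
        gcongr
    _ = α * (36 / c ^ 3) * l2norm x := by field_simp; ring

/-! ### Probability of the good event -/

/-- `G` has no isolated vertex and satisfies the relative error bound with constant `C`, cleared
of denominators so that no sign conditions are involved. -/
def GoodGraph {n : ℕ} (m k : ℕ) (p q : I) (α C : ℝ) (G : SimpleGraph (Fin n)) : Prop :=
  (∀ i, ∃ j, G.Adj i j) ∧
    (1 - α) * √(n * p / Real.log n) *
        l2norm (pageRank α k (adj G) - pageRank α k (meanAdj n m p q)) ≤
      α * C * l2norm (pageRank α k (meanAdj n m p q))

lemma measurableSet_graphs {n : ℕ} (s : Set (SimpleGraph (Fin n))) : MeasurableSet s := by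
  refine ⟨SimpleGraph.Adj '' s, (Set.toFinite _).measurableSet, ?_⟩
  exact Set.preimage_image_eq _ fun G H h => SimpleGraph.ext h

/-- The failure probability is at most `2 / n + 1 / log n`: Chernoff and a union bound for the
degrees, Markov for the single vector. -/
lemma law_not_goodGraph_le {n m k : ℕ} {p q : I} {c α : ℝ}
    (hn : 0 < n) (hc : 0 < c) (hpq : p ≤ q) (hq : 0 < (q : ℝ)) (hcq : c * q ≤ p)
    (hL : 1 ≤ Real.log n) (hLq : 64 * Real.log n ≤ c ^ 2 * (n * q)) (hα : 0 ≤ α) (hα1 : α < 1) :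
    law n m p q {G | ¬ GoodGraph m k p q α (36 / c ^ 3) G} ≤
      ENNReal.ofReal (2 / n + 1 / Real.log n) := by
  have hn' : (0 : ℝ) < n := by exact_mod_cast hn
  have hpq' : (p : ℝ) ≤ q := by exact_mod_cast hpq
  set L := Real.log n with hLdef
  set b : ℝ := n * q with hb
  have hb0 : 0 < b := mul_pos hn' hq
  have hc1 : c ≤ 1 := le_of_mul_le_mul_right (by linarith) hq
  have hLb : L ≤ b := by
    nlinarith [mul_le_mul_of_nonneg_right (pow_le_one₀ hc.le hc1 : c ^ 2 ≤ 1) hb0.le]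
  have hL0 : 0 < L := by linarith
  set r : ℝ := √(b * L) with hr
  have hr2 : r ^ 2 = b * L := Real.sq_sqrt (by positivity)
  set y : Fin n → ℝ := fun i => pageRank α k (meanAdj n m p q) i * (∑ j, meanAdj n m p q i j)⁻¹
  -- the minimizer of the Chernoff exponent, up to a constant
  set s : ℝ := √(L / b) with hs
  have hs2 : s ^ 2 = L / b := Real.sq_sqrt (by positivity)
  have hs1 : s ≤ 1 := Real.sqrt_le_one.2 ((div_le_one hb0).2 hLb)
  have hsr : s * r = L := by
    rw [hs, hr, ← Real.sqrt_mul (by positivity), show L / b * (b * L) = L * L by field_simp,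
      Real.sqrt_mul_self hL0.le]
  rw [law, Measure.map_apply measurable_toGraph (measurableSet_graphs _)]
  have hsub : toGraph ⁻¹' {G | ¬ GoodGraph m k p q α (36 / c ^ 3) G} ⊆
      (⋃ i : Fin n, {ω | 3 * r ≤ |∑ j, noiseMatrix m p q ω i j|}) ∪
        {ω | r * l2norm y < l2norm (y ᵥ* noiseMatrix m p q ω)} := by
    intro ω hω
    by_contra hbad
    simp only [Set.mem_union, Set.mem_iUnion, not_or, not_exists] at hbad
    exact hω (l2norm_pageRank_sub_le hn hc hpq hq hcq hL hLq hα hα1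
      (fun i => (not_le.1 (hbad.1 i)).le) (not_lt.1 hbad.2))
  refine (measure_mono hsub).trans ?_
  rw [← ofReal_measureReal]
  refine ENNReal.ofReal_le_ofReal ((measureReal_union_le _ _).trans (add_le_add ?_ ?_))
  · refine (measureReal_iUnion_fintype_le _).trans ?_
    calc ∑ i : Fin n, (coinLaw n m p q).real {ω | 3 * r ≤ |∑ j, noiseMatrix m p q ω i j|}
        ≤ ∑ _i : Fin n, 2 * Real.exp (-(s * (3 * r)) + n * q * s ^ 2) :=
          Finset.sum_le_sum fun i _ =>
            measure_abs_sum_noise_ge_le hpq i (Real.sqrt_nonneg _) hs1 _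
      _ = n * (2 * Real.exp (-L + -L)) := by
          rw [Finset.sum_const, Finset.card_univ, Fintype.card_fin, nsmul_eq_mul, ← hb, hs2,
            mul_div_cancel₀ _ hb0.ne']
          congr 3
          linarith
      _ = 2 / n := by
          rw [Real.exp_add, Real.exp_neg, hLdef, Real.exp_log hn']
          field_simp
  · refine (measure_l2norm_vecMul_noiseMatrix_gt_le hpq y (by positivity)).trans_eq ?_
    rw [hr2, ← hb]
    field_simp

end PlantedER

/-! ### The limit -/

open PlantedER in
theorem theorem1 (m : ℕ → ℕ) (p q : ℕ → I)
    (hm : ∀ᶠ n in atTop, m n ≤ n)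
    (hpq : ∀ᶠ n in atTop, p n < q n)
    (hq : (fun n : ℕ => Real.log n) =o[atTop] fun n : ℕ => (n : ℝ) * (q n : ℝ))
    (hΘ : (fun n : ℕ => (p n : ℝ) / (q n : ℝ)) =Θ[atTop] fun _ : ℕ => (1 : ℝ)) :
    (∀ (k : ℕ → ℕ) (α : ℝ), (∀ᶠ n in atTop, 1 ≤ k n ∧ k n ≤ m n) → 0 ≤ α → α < 1 →
      ∀ ε : ℝ, 0 < ε →
        Tendsto (fun n => PlantedER.law n (m n) (p n) (q n)
          {G | ε ≤ PlantedER.relError (m n) (k n) (p n) (q n) α G}) atTop (𝓝 0)) ∧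
    ∃ C : ℝ, 0 < C ∧
      ∀ (k : ℕ → ℕ) (α : ℝ), (∀ᶠ n in atTop, 1 ≤ k n ∧ k n ≤ m n) → 0 ≤ α → α < 1 →
        PlantedER.AAS m p q fun n G =>
          (∀ i : Fin n, ∃ j : Fin n, G.Adj i j) ∧
          PlantedER.relError (m n) (k n) (p n) (q n) α G ≤
            α * C / ((1 - α) * Real.sqrt (n * (p n : ℝ) / Real.log n) - α * C) := by
  have hlog : Tendsto (fun n : ℕ => Real.log n) atTop atTop :=
    Real.tendsto_log_atTop.comp tendsto_natCast_atTop_atTop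
  have hqpos : ∀ᶠ n in atTop, 0 < (q n : ℝ) := by
    filter_upwards [hpq] with n h
    exact lt_of_le_of_lt (p n).2.1 (by exact_mod_cast h)
  obtain ⟨c, hc, hcq⟩ : ∃ c : ℝ, 0 < c ∧ ∀ᶠ n in atTop, c * q n ≤ p n := by
    obtain ⟨K, hK, hKb⟩ := hΘ.2.exists_pos
    refine ⟨K⁻¹, inv_pos.2 hK, ?_⟩
    filter_upwards [hKb.bound, hqpos] with n h h0
    rw [norm_one, Real.norm_of_nonneg (div_nonneg (p n).2.1 h0.le), ← mul_div_assoc,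
      le_div_iff₀ h0, one_mul] at h
    rwa [inv_mul_le_iff₀ hK]
  have hLq : ∀ M : ℝ, 0 < M → ∀ᶠ n : ℕ in atTop, M * Real.log n ≤ c ^ 2 * (n * q n) := by
    intro M hM
    filter_upwards [hq.bound (show 0 < c ^ 2 / M by positivity), hlog.eventually_ge_atTop 0]
      with n h h0
    rw [Real.norm_of_nonneg h0,
      Real.norm_of_nonneg (mul_nonneg (Nat.cast_nonneg n) (q n).2.1)] at h
    calc M * Real.log n ≤ M * (c ^ 2 / M * (n * q n)) := by gcongr
      _ = c ^ 2 * (n * q n) := by field_simp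
  have hS : ∀ M : ℝ, ∀ᶠ n : ℕ in atTop, M < √(n * p n / Real.log n) := by
    intro M
    filter_upwards [hLq (c * (|M| + 1) ^ 2) (by positivity), hcq,
      hlog.eventually_gt_atTop 0] with n h1 h2 h3
    refine (lt_of_le_of_lt (le_abs_self M) (lt_add_one _)).trans_le (Real.le_sqrt_of_sq_le ?_)
    rw [le_div_iff₀ h3]
    refine le_of_mul_le_mul_left ?_ hc
    calc c * ((|M| + 1) ^ 2 * Real.log n) = c * (|M| + 1) ^ 2 * Real.log n := by ring
      _ ≤ c ^ 2 * (n * q n) := h1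
      _ = c * (n * (c * q n)) := by ring
      _ ≤ c * (n * p n) := by gcongr
  set C : ℝ := 36 / c ^ 3 with hC
  have hC0 : 0 < C := by positivity
  have hbad : ∀ (k : ℕ → ℕ) (α : ℝ), 0 ≤ α → α < 1 →
      Tendsto (fun n => law n (m n) (p n) (q n)
        {G | ¬ GoodGraph (m n) (k n) (p n) (q n) α C G}) atTop (𝓝 0) := by
    intro k α hα hα1
    have hlim : Tendsto (fun n : ℕ => ENNReal.ofReal (2 / n + 1 / Real.log n)) atTop (𝓝 0) := by
      have h := ENNReal.tendsto_ofReal ((tendsto_const_nhds (x := (2 : ℝ))).div_atTop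
        (tendsto_natCast_atTop_atTop (R := ℝ)) |>.add
          ((tendsto_const_nhds (x := (1 : ℝ))).div_atTop hlog))
      simpa using h
    refine tendsto_of_tendsto_of_tendsto_of_le_of_le' tendsto_const_nhds hlim
      (Eventually.of_forall fun n => zero_le) ?_
    filter_upwards [eventually_gt_atTop 0, hpq, hqpos, hcq, hlog.eventually_ge_atTop 1,
      hLq 64 (by norm_num)] with n h1 h2 h3 h4 h5 h6
    exact law_not_goodGraph_le h1 hc h2.le h3 h4 h5 h6 hα hα1
  have hrel : ∀ (k : ℕ → ℕ) (α : ℝ) (n : ℕ) (G : SimpleGraph (Fin n)), 0 ≤ α → α < 1 →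
      GoodGraph (m n) (k n) (p n) (q n) α C G → 0 < √(n * p n / Real.log n) →
      relError (m n) (k n) (p n) (q n) α G ≤ α * C / ((1 - α) * √(n * p n / Real.log n)) := by
    intro k α n G hα hα1 hG hpos
    have h1 : 0 < (1 - α) * √(n * p n / Real.log n) := mul_pos (by linarith) hpos
    refine div_le_of_le_mul₀ (l2norm_nonneg _) (by positivity) ?_
    rw [div_mul_eq_mul_div, le_div_iff₀ h1, mul_comm]
    exact hG.2
  refine ⟨fun k α _ hα hα1 ε hε => ?_, C, hC0, fun k α _ hα hα1 => ?_⟩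
  · refine tendsto_of_tendsto_of_tendsto_of_le_of_le' tendsto_const_nhds (hbad k α hα hα1)
      (Eventually.of_forall fun n => zero_le) ?_
    filter_upwards [hS 0, hS (α * C / ((1 - α) * ε))] with n h0 h
    refine measure_mono fun G (hG : ε ≤ _) hgood => hG.not_gt ?_
    refine (hrel k α n G hα hα1 hgood h0).trans_lt ?_
    have h1 : 0 < 1 - α := by linarith
    rw [div_lt_iff₀ (by positivity)] at h ⊢
    linarith
  · have h1 : Tendsto (fun n => 1 - law n (m n) (p n) (q n)
        {G | ¬ GoodGraph (m n) (k n) (p n) (q n) α C G}) atTop (𝓝 1) := by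
      simpa using ENNReal.Tendsto.sub tendsto_const_nhds (hbad k α hα hα1) (by simp)
    refine tendsto_of_tendsto_of_tendsto_of_le_of_le' h1 tendsto_const_nhds ?_
      (Eventually.of_forall fun n => prob_le_one)
    filter_upwards [hS 0, hS (α * C / (1 - α))] with n h0 h
    rw [← prob_compl_eq_one_sub (measurableSet_graphs _)]
    refine measure_mono fun G hG => ?_
    have hgood : GoodGraph (m n) (k n) (p n) (q n) α C G := not_not.1 hG
    refine ⟨hgood.1, (hrel k α n G hα hα1 hgood h0).trans ?_⟩
    have h2 : 0 < 1 - α := by linarith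
    rw [div_lt_iff₀ h2] at h
    -- the denominator in the claim is positive for large `n`, since `n p / log n → ∞`
    gcongr
    · linarith
    · linarith [mul_nonneg hα hC0.le]
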